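/- Let $\beta\in(1,2)$ be the tribonacci number, i.e. the unique root in $(1,2)$ of $x^3=x^2+x+1$. Let $T_\beta:[0,1)\to[0,1)$, $T_\beta(x)=\beta x \pmod 1$, and for $t\in[0,1)$ let $$K_\beta(t)=\{x\in[0,1): T_\beta^n(x)\ge t \text{ for all } n\ge 0\}.$$ For an integer $p\ge 1$ put $$S_\beta(p)=\sup\{t\in[0,1): K_\beta(t)\text{ contains a periodic point of } T_\beta \text{ of smallest period } p\}.$$ For a sequence $(d_i)_{i\ge1}\in\{0,1\}^{\mathbb N}$ write $[(d_i)]_\beta=\sum_{i\ge1} d_i\beta^{-i}$; for a finite word $w$ let $w^k$ be its $k$-fold concatenation ($w^0$ is empty) and $w^\infty=www\cdots$. The quasi-greedy $\beta$-expansion of $1$ is the lexicographically largest sequence $(d_i)\in\{0,1\}^{\mathbb N}$ that does not end in $0^\infty$ and satisfies $[(d_i)]_\beta=1$. Then the quasi-greedy $\beta$-expansion of $1$ is $(110)^\infty$; for every $p\ge1$ the set in the definition of $S_\beta(p)$ is nonempty and bounded above; and $$S_\beta(1)=0,\quad S_\beta(3)=[(001)^\infty]_\beta,\quad S_\beta(4)=[(0011)^\infty]_\beta,\quad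 S_\beta(6)=[(001101)^\infty]_\beta,$$ $$S_\beta(p)=\begin{cases} [(01(011)^m)^\infty]_\beta, & p=3m+2,\ m\ge 0,\\ [(01(011)^{z-1}01(011)^z)^\infty]_\beta, & p=3m+1,\ m=2z,\ z\ge1,\\ [(01(011)^{z-1}01(011)^{z+1})^\infty]_\beta, & p=3m+1,\ m=2z+1,\ z\ge1,\\ [(01(011)^{z-1}01(011)^{z-1}01(011)^z)^\infty]_\beta, & p=3m,\ m=3z,\ z\ge1,\\ [(01(011)^{z-1}01(011)^z01(011)^z)^\infty]_\beta, & p=3m,\ m=3z+1,\ z\ge1,\\ [(01(011)^{z-1}01(011)^{z+1}01(011)^z)^\infty]_\beta, & p=3m,\ m=3z+2,\ z\ge1. \end{cases}$$ -/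

import Mathlib

open Set

/-- The `β`-transformation `x ↦ β x (mod 1)`. It maps `[0,1)` into itself, so on points of `[0,1)`
its iterates and periods are those of the map `[0,1) → [0,1)`. -/
noncomputable def betaMap (β : ℝ) (x : ℝ) : ℝ := Int.fract (β * x)

/-- The survivor set `K_β(t)`: points of `[0,1)` whose whole orbit stays in `[t, ∞)`. -/
def survivorSet (β t : ℝ) : Set ℝ :=
  {x | x ∈ Ico (0 : ℝ) 1 ∧ ∀ n : ℕ, t ≤ (betaMap β)^[n] x}

/-- The set of `t ∈ [0,1)` such that `K_β(t)` contains a point of smallest period `p`.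
(`Function.minimalPeriod f x` is the smallest period of `x`, and it is positive exactly when `x`
is periodic; the set is used for `p ≥ 1`.) -/
def periodThresholds (β : ℝ) (p : ℕ) : Set ℝ :=
  {t | t ∈ Ico (0 : ℝ) 1 ∧ ∃ x ∈ survivorSet β t, Function.minimalPeriod (betaMap β) x = p}

/-- The critical value `S_β(p)`. -/
noncomputable def criticalValue (β : ℝ) (p : ℕ) : ℝ := sSup (periodThresholds β p)

/-- The word `w^m`. -/
def wordPow (w : List (Fin 2)) (m : ℕ) : List (Fin 2) := (List.replicate m w).flatten

/-- The periodic sequence `w^∞` (for a nonempty word `w`); index `n` is the `(n+1)`-st digit. -/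
def wordInf (w : List (Fin 2)) : ℕ → Fin 2 := fun n => w.getD (n % w.length) 0

/-- `[(d_1 d_2 d_3 ⋯)]_β = ∑_{i ≥ 1} d_i / β^i`, where `d_i` is `d (i - 1)`.
The series converges for every `β > 1`. -/
noncomputable def betaValue (β : ℝ) (d : ℕ → Fin 2) : ℝ :=
  ∑' n : ℕ, ((d n : ℕ) : ℝ) / β ^ (n + 1)

/-- `d` is an infinite `β`-expansion of `x` with digits `0, 1`: it represents `x`
and does not end with `0^∞`. -/
def IsInfiniteExpansion (β x : ℝ) (d : ℕ → Fin 2) : Prop :=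
  HasSum (fun n : ℕ => ((d n : ℕ) : ℝ) / β ^ (n + 1)) x ∧ ∀ N : ℕ, ∃ n ≥ N, d n ≠ 0

/-- `d` is the quasi-greedy `β`-expansion of `x` (for `1 < β ≤ 2`): the lexicographically largest
infinite `β`-expansion of `x`. -/
def IsQuasiGreedyExpansion (β x : ℝ) (d : ℕ → Fin 2) : Prop :=
  IsInfiniteExpansion β x d ∧
    ∀ c : ℕ → Fin 2, IsInfiniteExpansion β x c → toLex c ≤ toLex d

/-- The word `01`. -/
def word01 : List (Fin 2) := [0, 1]

/-- The word `011`. -/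
def word011 : List (Fin 2) := [0, 1, 1]

/-! Write b = β⁻¹, so b + b² + b³ = 1. Expansions are handled through inverse branches: a point
whose expansion starts with a word `w` is the image of a later orbit point under the increasing
contraction `wordBranch β w`, and `w^∞` is coded by its unique fixed point. Three thresholds read
off digits: a point below b starts with 0, a point below b² starts with 00, and 1 - b = b² + b³
separates 010 from 011. The word 111 has value 1, so it never occurs in an orbit.

A periodic orbit that stays above b² contains neither 00 nor 111, so from any 0 onwards it is a
concatenation of 01 and 011. It cannot be all 011, since `(011)^∞` represents b, which is not below
b. Hence it is a cyclic concatenation of blocks `01(011)^k` (`exists_blockChain`). Larger k gives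
larger points (`block_lt_block`), so orbit points at block boundaries are ordered by their sequences
of exponents (`block_compare`).

For r blocks with exponents of sum s the period is p = 2r + 3s, so p mod 3 determines r mod 3. The
claimed words use the least possible r, namely 1, 2 or 3, with exponents as equal as primitivity
permits. If an orbit lay strictly above such a word, all its exponents would be at least the first
exponent of that word. This bounds r. The finitely many remaining exponent patterns are
non-primitive, are rotations of the claimed word, or contain a rotation that is too small
(`isGreatest_one_block`, `isGreatest_two_blocks`, `isGreatest_three_blocks`).

For p = 1, 3, 4, 6 no block word of smallest period p exists. For p = 1 only the fixed point 0
remains. For the others the orbit must contain 00, and following it digit by digit from there forces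
the claimed word. -/

/-- The inverse branch of the `β`-transformation with digit `d`. -/
noncomputable def branch (β : ℝ) (d : Fin 2) (x : ℝ) : ℝ := β⁻¹ * (((d : ℕ) : ℝ) + x)

/-- The composition of the inverse branches along a word. -/
noncomputable def wordBranch (β : ℝ) (w : List (Fin 2)) (x : ℝ) : ℝ := w.foldr (branch β) x

/-- The word `01(011)^k`. -/
def block (k : ℕ) : List (Fin 2) := word01 ++ wordPow word011 k

/-! ### Words as increasing affine contractions -/

@[simp] lemma wordBranch_nil (β x : ℝ) : wordBranch β [] x = x := rfl

lemma wordBranch_cons (β x : ℝ) (d : Fin 2) (w : List (Fin 2)) :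
    wordBranch β (d :: w) x = branch β d (wordBranch β w x) := rfl

lemma wordBranch_append (β x : ℝ) (u w : List (Fin 2)) :
    wordBranch β (u ++ w) x = wordBranch β u (wordBranch β w x) := by
  simp [wordBranch]

lemma branch_zero (β x : ℝ) : branch β 0 x = β⁻¹ * x := by simp [branch]

lemma branch_one (β x : ℝ) : branch β 1 x = β⁻¹ * (1 + x) := by simp [branch]

lemma wordPow_succ (w : List (Fin 2)) (k : ℕ) : wordPow w (k + 1) = w ++ wordPow w k := by
  simp [wordPow, List.replicate_succ]

@[simp] lemma wordPow_zero (w : List (Fin 2)) : wordPow w 0 = [] := rfl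

lemma wordPow_add (w : List (Fin 2)) (k l : ℕ) :
    wordPow w (k + l) = wordPow w k ++ wordPow w l := by
  rw [wordPow, List.replicate_add, List.flatten_append]; rfl

lemma length_wordPow (w : List (Fin 2)) (k : ℕ) : (wordPow w k).length = k * w.length := by
  simp [wordPow]

lemma wordBranch_sub (β x y : ℝ) (w : List (Fin 2)) :
    wordBranch β w x - wordBranch β w y = β⁻¹ ^ w.length * (x - y) := by
  induction w with
  | nil => simp
  | cons d w ih =>
    rw [wordBranch_cons, wordBranch_cons, List.length_cons, pow_succ', mul_assoc, ← ih]
    simp only [branch]; ring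

lemma wordBranch_strictMono {β : ℝ} (hβ1 : 1 < β) (w : List (Fin 2)) :
    StrictMono (wordBranch β w) := by
  intro x y h
  have := wordBranch_sub β y x w
  have h2 : 0 < β⁻¹ ^ w.length * (y - x) := by
    have := sub_pos.2 h
    positivity
  linarith

lemma wordBranch_nonneg {β : ℝ} (hβ1 : 1 < β) (w : List (Fin 2)) {x : ℝ} (hx : 0 ≤ x) :
    0 ≤ wordBranch β w x := by
  induction w with
  | nil => simpa
  | cons d w ih => rw [wordBranch_cons, branch]; positivity

lemma inv_pow_lt_one {β : ℝ} (hβ1 : 1 < β) {n : ℕ} (hn : n ≠ 0) : β⁻¹ ^ n < 1 :=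
  pow_lt_one₀ (by positivity) (inv_lt_one_of_one_lt₀ hβ1) hn

/-- The branch of a nonempty word is a contraction, so a point moved down by it lies above
its fixed point. -/
lemma lt_of_wordBranch_lt {β : ℝ} (hβ1 : 1 < β) {w : List (Fin 2)} (hw : w ≠ []) {v c : ℝ}
    (hv : v = wordBranch β w v) (hc : wordBranch β w c < c) : v < c := by
  have h := wordBranch_sub β v c w
  have h1 := inv_pow_lt_one hβ1 (n := w.length) (by simpa using hw)
  by_contra! hcv
  nlinarith

lemma eq_of_wordBranch_eq {β : ℝ} (hβ1 : 1 < β) {w : List (Fin 2)} (hw : w ≠ []) {v c : ℝ}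
    (hv : v = wordBranch β w v) (hc : c = wordBranch β w c) : v = c := by
  have h := wordBranch_sub β v c w
  have h1 := inv_pow_lt_one hβ1 (n := w.length) (by simpa using hw)
  rw [← hv, ← hc] at h
  have : (1 - β⁻¹ ^ w.length) * (v - c) = 0 := by linarith
  rcases mul_eq_zero.1 this with h | h <;> linarith

lemma inv_tribonacci {β : ℝ} (hβ1 : 1 < β) (hβ : β ^ 3 = β ^ 2 + β + 1) :
    β⁻¹ ^ 3 = 1 - β⁻¹ - β⁻¹ ^ 2 := by
  have : β ≠ 0 := by positivity
  field_simp
  linarith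

/-! ### Values of digit sequences -/

lemma summable_digits {β : ℝ} (hβ1 : 1 < β) (d : ℕ → Fin 2) :
    Summable fun n : ℕ => ((d n : ℕ) : ℝ) / β ^ (n + 1) := by
  have hs : Summable fun n : ℕ => β⁻¹ * β⁻¹ ^ n :=
    (summable_geometric_of_lt_one (by positivity) (inv_lt_one_of_one_lt₀ hβ1)).mul_left _
  refine Summable.of_nonneg_of_le (fun n => by positivity) (fun n => ?_) hs
  have : ((d n : ℕ) : ℝ) ≤ 1 := by exact_mod_cast Nat.lt_succ_iff.1 (d n).2
  rw [← pow_succ', inv_pow, div_eq_mul_inv]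
  have h : 0 ≤ (β ^ (n + 1))⁻¹ := by positivity
  nlinarith

lemma betaValue_nonneg {β : ℝ} (hβ1 : 1 < β) (d : ℕ → Fin 2) : 0 ≤ betaValue β d :=
  tsum_nonneg fun n => by positivity

lemma betaValue_eq_branch {β : ℝ} (hβ1 : 1 < β) (d : ℕ → Fin 2) :
    betaValue β d = branch β (d 0) (betaValue β fun n => d (n + 1)) := by
  rw [betaValue, (summable_digits hβ1 d).tsum_eq_zero_add, branch, betaValue, mul_add,
    ← tsum_mul_left]
  congr 1
  · simp [div_eq_inv_mul]
  · congr 1; ext n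
    rw [pow_succ' β (n + 1)]
    field_simp

lemma betaValue_eq_wordBranch {β : ℝ} (hβ1 : 1 < β) (n : ℕ) (d : ℕ → Fin 2) :
    betaValue β d =
      wordBranch β ((List.range n).map d) (betaValue β fun k => d (k + n)) := by
  induction n generalizing d with
  | zero => simp
  | succ n ih =>
    rw [betaValue_eq_branch hβ1, ih, List.range_succ_eq_map, List.map_cons, wordBranch_cons,
      List.map_map]
    rfl

lemma wordInf_add_length (w : List (Fin 2)) (n : ℕ) :
    wordInf w (n + w.length) = wordInf w n := by
  simp [wordInf]

lemma map_wordInf (w : List (Fin 2)) : (List.range w.length).map (wordInf w) = w := by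
  apply List.ext_getElem (by simp)
  intro i h1 h2
  simp [wordInf, Nat.mod_eq_of_lt h2, List.getElem?_eq_getElem h2]

lemma betaValue_wordInf {β : ℝ} (hβ1 : 1 < β) (w : List (Fin 2)) :
    betaValue β (wordInf w) = wordBranch β w (betaValue β (wordInf w)) := by
  conv_lhs => rw [betaValue_eq_wordBranch hβ1 w.length]
  simp only [wordInf_add_length, map_wordInf]

lemma betaValue_pos {β : ℝ} (hβ1 : 1 < β) {d : ℕ → Fin 2} {n : ℕ} (hn : d n ≠ 0) :
    0 < betaValue β d := by
  refine (summable_digits hβ1 d).tsum_pos (fun n => by positivity) n ?_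
  have : 0 < (d n : ℕ) := Nat.pos_of_ne_zero fun h => hn (Fin.ext h)
  positivity

theorem isQuasiGreedyExpansion_one {β : ℝ} (hβ1 : 1 < β) (hβ : β ^ 3 = β ^ 2 + β + 1) :
    IsQuasiGreedyExpansion β 1 (wordInf [1, 1, 0]) := by
  have hb := inv_tribonacci hβ1 hβ
  have hb1 : β⁻¹ ^ 3 < 1 := inv_pow_lt_one hβ1 (by norm_num)
  have hval : betaValue β (wordInf [1, 1, 0]) = 1 := by
    have h1 : (1 : ℝ) = wordBranch β [1, 1, 0] 1 := by
      simp only [wordBranch_cons, wordBranch_nil, branch_zero, branch_one]; linarith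
    exact eq_of_wordBranch_eq hβ1 (by simp) (betaValue_wordInf hβ1 _) h1
  have hvalue : ∀ n, betaValue β (fun k => wordInf [1, 1, 0] (k + 3 * n)) = 1 := by
    intro n
    rw [← hval]; congr 1; ext k
    simp [wordInf]
  refine ⟨⟨by simpa [← hval, betaValue] using (summable_digits hβ1 _).hasSum, fun N =>
    ⟨3 * N, by omega, by simp [wordInf]⟩⟩, ?_⟩
  intro c hc
  -- A larger expansion `c` first differs where `(110)^∞` has a 0, so some tail of `c` starts with
  -- 111 and has value 1. The word 111 already has value 1, so only zeros could follow.
  by_contra! hlt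
  obtain ⟨i, hi, hlt⟩ := hlt
  simp only [Pi.toLex_apply] at hi hlt
  have hvc : betaValue β c = 1 := hc.1.tsum_eq
  have hci : c i = 1 := by omega
  have hdi : wordInf [1, 1, 0] i = 0 := by omega
  obtain ⟨m, rfl⟩ : ∃ m, i = 3 * m + 2 := by
    refine ⟨i / 3, ?_⟩
    have h3 : i % 3 < 3 := Nat.mod_lt _ (by norm_num)
    have : i % 3 = 2 := by
      interval_cases h : i % 3 <;> simp [wordInf, h] at hdi ⊢
    omega
  have e : (List.range (3 * m)).map c = (List.range (3 * m)).map (wordInf [1, 1, 0]) := by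
    apply List.map_congr_left
    intro j hj
    exact (hi j (by have := List.mem_range.1 hj; omega)).symm
  have h1 := betaValue_eq_wordBranch hβ1 (3 * m) c
  have h2 := betaValue_eq_wordBranch hβ1 (3 * m) (wordInf [1, 1, 0])
  rw [hvc, e] at h1
  rw [hval, hvalue] at h2
  have h3 := (wordBranch_strictMono hβ1 _).injective (h1.symm.trans h2)
  have c0 : c (3 * m) = 1 := by rw [← hi _ (by omega)]; simp [wordInf]
  have c1 : c (3 * m + 1) = 1 := by rw [← hi _ (by omega)]; simp [wordInf, Nat.add_mod]
  rw [betaValue_eq_wordBranch hβ1 3] at h3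
  have e3 : (List.range 3).map (fun k => c (k + 3 * m)) = [1, 1, 1] := by
    simp [List.range_succ, c0, c1, add_comm 1, add_comm 2, hci]
  rw [e3] at h3
  simp only [wordBranch_cons, wordBranch_nil, branch_one] at h3
  obtain ⟨n, hn, hcn⟩ := hc.2 (3 * m + 3)
  have hpos := betaValue_pos hβ1 (d := fun k => c (k + 3 + 3 * m)) (n := n - (3 * m + 3))
    (by rwa [show n - (3 * m + 3) + 3 + 3 * m = n by omega])
  have : 0 < β⁻¹ ^ 3 := by positivity
  nlinarith [mul_pos this hpos]

/-! ### Blocks `01(011)^k` -/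

lemma block_zero : block 0 = word01 := rfl

lemma block_succ (k : ℕ) : block (k + 1) = block k ++ word011 := by
  rw [block, wordPow_add, ← List.append_assoc, block]; simp [wordPow]

lemma wordBranch_word01 (β x : ℝ) : wordBranch β word01 x = β⁻¹ ^ 2 * (1 + x) := by
  simp only [word01, wordBranch_cons, wordBranch_nil, branch_zero, branch_one]; ring

lemma wordBranch_word011 {β : ℝ} (hβ1 : 1 < β) (hβ : β ^ 3 = β ^ 2 + β + 1) (x : ℝ) :
    wordBranch β word011 x = 1 - β⁻¹ + β⁻¹ ^ 3 * x := by
  have hb := inv_tribonacci hβ1 hβ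
  simp only [word011, wordBranch_cons, wordBranch_nil, branch_zero, branch_one]
  linear_combination hb

/-- The fixed point of the increasing map `wordBranch β word011` is β⁻¹, because `(110)^∞` has value
1. -/
lemma wordBranch_word011_lt {β : ℝ} (hβ1 : 1 < β) (hβ : β ^ 3 = β ^ 2 + β + 1) {x : ℝ}
    (hx : x < β⁻¹) : wordBranch β word011 x < β⁻¹ := by
  have hb := inv_tribonacci hβ1 hβ
  have h3 : 0 < β⁻¹ ^ 3 := by positivity
  have : β⁻¹ = wordBranch β word011 β⁻¹ := by
    rw [wordBranch_word011 hβ1 hβ]; linear_combination (-1 - β⁻¹) * hb + 2 * hb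
  rw [this]
  exact wordBranch_strictMono hβ1 _ hx

lemma wordBranch_block_lt {β : ℝ} (hβ1 : 1 < β) (hβ : β ^ 3 = β ^ 2 + β + 1) (k : ℕ) {x : ℝ}
    (hx : x < β⁻¹) : wordBranch β (block k) x < 1 - β⁻¹ := by
  induction k generalizing x with
  | zero =>
    rw [block_zero, wordBranch_word01]
    have hb := inv_tribonacci hβ1 hβ
    have h2 : 0 < β⁻¹ ^ 2 := by positivity
    nlinarith
  | succ k ih =>
    rw [block_succ, wordBranch_append]
    exact ih (wordBranch_word011_lt hβ1 hβ hx)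

lemma le_wordBranch_block {β : ℝ} (hβ1 : 1 < β) (k : ℕ) {x : ℝ} (hx : 0 ≤ x) :
    β⁻¹ ^ 2 ≤ wordBranch β (block k) x := by
  rw [block, wordBranch_append, wordBranch_word01]
  have := wordBranch_nonneg hβ1 (wordPow word011 k) hx
  have h2 : 0 < β⁻¹ ^ 2 := by positivity
  nlinarith

/-- After the common prefix `block k` the larger word continues with 011, hence from a point at
least 1 - β⁻¹, while `y` lies below that threshold. -/
lemma block_lt_block {β : ℝ} (hβ1 : 1 < β) (hβ : β ^ 3 = β ^ 2 + β + 1) {k l : ℕ} (hkl : k < l)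
    {y v : ℝ} (hy : y < 1 - β⁻¹) (hv : 0 ≤ v) :
    wordBranch β (block k) y < wordBranch β (block l) v := by
  obtain ⟨s, rfl⟩ : ∃ s, l = k + (1 + s) := ⟨l - k - 1, by omega⟩
  have e : block (k + (1 + s)) = block k ++ (word011 ++ wordPow word011 s) := by
    rw [block, wordPow_add, wordPow_add, ← List.append_assoc, block]; simp [wordPow]
  rw [e, wordBranch_append]
  apply wordBranch_strictMono hβ1
  rw [wordBranch_append, wordBranch_word011 hβ1 hβ]
  have := wordBranch_nonneg hβ1 (wordPow word011 s) hv
  have h3 : 0 < β⁻¹ ^ 3 := by positivity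
  nlinarith

lemma inv_tribonacci_bounds {β : ℝ} (hβ1 : 1 < β) (hβ : β ^ 3 = β ^ 2 + β + 1) :
    1 - β⁻¹ < β⁻¹ ∧ β⁻¹ ^ 2 < 1 - β⁻¹ ∧ β⁻¹ * (1 + β⁻¹) < 1 ∧ 0 < β⁻¹ ∧ β⁻¹ < 1 ∧
      0 < β⁻¹ ^ 2 := by
  have hb := inv_tribonacci hβ1 hβ
  have h1 : β⁻¹ < 1 := inv_lt_one_of_one_lt₀ hβ1
  have h0 : 0 < β⁻¹ := by positivity
  have h3 : 0 < β⁻¹ ^ 3 := by positivity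
  have h2 : 0 < β⁻¹ ^ 2 := by positivity
  refine ⟨?_, by linarith, by linarith, h0, h1, h2⟩
  by_contra! h
  nlinarith [mul_le_mul h h h0.le (by linarith)]

/-! ### Orbits of the `β`-transformation -/

lemma betaMap_mem (β x : ℝ) : betaMap β x ∈ Ico (0 : ℝ) 1 :=
  ⟨Int.fract_nonneg _, Int.fract_lt_one _⟩

lemma betaMap_branch {β : ℝ} (hβ1 : 1 < β) (d : Fin 2) {x : ℝ} (hx0 : 0 ≤ x) (hx1 : x < 1) :
    betaMap β (branch β d x) = x := by
  have : β ≠ 0 := by positivity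
  rw [betaMap, branch, mul_inv_cancel_left₀ this, Int.fract_natCast_add]
  exact Int.fract_eq_self.2 ⟨hx0, hx1⟩

lemma iterate_betaMap_mem (β : ℝ) {x : ℝ} (hx : x ∈ Ico (0 : ℝ) 1) (n : ℕ) :
    (betaMap β)^[n] x ∈ Ico (0 : ℝ) 1 := by
  cases n with
  | zero => simpa
  | succ n => rw [Function.iterate_succ_apply']; exact betaMap_mem _ _

lemma eq_branch_zero {β : ℝ} (hβ1 : 1 < β) {x : ℝ} (hx0 : 0 ≤ x) (hx : x < β⁻¹) :
    x = branch β 0 (betaMap β x) := by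
  have h0 : 0 < β := by positivity
  have h1 : β * x < 1 := by
    have := mul_lt_mul_of_pos_left hx h0
    rwa [mul_inv_cancel₀ h0.ne'] at this
  rw [branch_zero, betaMap, Int.fract_eq_self.2 ⟨by positivity, h1⟩, inv_mul_cancel_left₀ h0.ne']

lemma eq_branch_one {β : ℝ} (hβ1 : 1 < β) (hβ2 : β < 2) {x : ℝ} (hx1 : x < 1) (hx : β⁻¹ ≤ x) :
    x = branch β 1 (betaMap β x) := by
  have h0 : 0 < β := by positivity
  have h1 : 1 ≤ β * x := by
    have := mul_le_mul_of_nonneg_left hx h0.le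
    rwa [mul_inv_cancel₀ h0.ne'] at this
  have hf : ⌊β * x⌋ = 1 := by
    rw [Int.floor_eq_iff]; push_cast; constructor <;> nlinarith
  rw [branch_one, betaMap, Int.fract, hf]
  push_cast
  rw [add_sub_cancel, inv_mul_cancel_left₀ h0.ne']

/-- The orbit of `x` reaches `y` after `N` steps and stays above `v` strictly in between. -/
def Rises (β v : ℝ) (N : ℕ) (x y : ℝ) : Prop :=
  (betaMap β)^[N] x = y ∧ ∀ n, 0 < n → n < N → v < (betaMap β)^[n] x

lemma Rises.trans {β v : ℝ} {M N : ℕ} {x y z : ℝ} (h1 : Rises β v M x y) (hy : v < y)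
    (h2 : Rises β v N y z) : Rises β v (M + N) x z := by
  refine ⟨by rw [add_comm, Function.iterate_add_apply, h1.1, h2.1], fun n hn hnN => ?_⟩
  rcases lt_trichotomy n M with h | h | h
  · exact h1.2 n hn h
  · rwa [h, h1.1]
  · obtain ⟨m, rfl⟩ := Nat.exists_eq_add_of_lt h
    rw [show M + m + 1 = (m + 1) + M by ring, Function.iterate_add_apply, h1.1]
    exact h2.2 _ (by omega) (by omega)

lemma rises_branch {β : ℝ} (hβ1 : 1 < β) (v : ℝ) (d : Fin 2) {x : ℝ} (hx0 : 0 ≤ x) (hx1 : x < 1) :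
    Rises β v 1 (branch β d x) x :=
  ⟨by simpa using betaMap_branch hβ1 d hx0 hx1, fun n h1 h2 => by omega⟩

lemma rises_word01 {β : ℝ} (hβ1 : 1 < β) (hβ : β ^ 3 = β ^ 2 + β + 1) {v y : ℝ}
    (hv : v < β⁻¹) (hy0 : 0 ≤ y) (hy1 : y < β⁻¹) :
    Rises β v 2 (wordBranch β word01 y) y := by
  obtain ⟨-, -, h3, h4, h5, -⟩ := inv_tribonacci_bounds hβ1 hβ
  have e := branch_one β y
  exact (rises_branch hβ1 v 0 (x := branch β 1 y) (by rw [e]; positivity)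
    (by rw [e]; nlinarith)).trans (by rw [e]; nlinarith) (rises_branch hβ1 v 1 hy0 (by linarith))

/-- The bound `y < β⁻¹` is exactly what keeps the point coded by 11 followed by `y` below 1, so that
the digits 011 are those of the true orbit. -/
lemma rises_word011 {β : ℝ} (hβ1 : 1 < β) (hβ : β ^ 3 = β ^ 2 + β + 1) {v y : ℝ}
    (hv : v < β⁻¹) (hy0 : 0 ≤ y) (hy1 : y < β⁻¹) :
    Rises β v 3 (wordBranch β word011 y) y := by
  obtain ⟨-, -, h3, h4, h5, -⟩ := inv_tribonacci_bounds hβ1 hβ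
  have hb := inv_tribonacci hβ1 hβ
  have e := branch_one β y
  have e' := branch_one β (branch β 1 y)
  have h0 : 0 ≤ branch β 1 y := by rw [e]; positivity
  have h1 : branch β 1 y < β⁻¹ * (1 + β⁻¹) := by
    rw [e]; exact mul_lt_mul_of_pos_left (by linarith) h4
  refine (rises_branch hβ1 v 0 (x := branch β 1 (branch β 1 y)) (by rw [e']; positivity)
    ?_).trans ?_ ((rises_branch hβ1 v 1 h0 (by linarith)).trans ?_
      (rises_branch hβ1 v 1 hy0 (by linarith)))
  · rw [e']
    have := mul_lt_mul_of_pos_left h1 h4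
    linarith
  · rw [e']; nlinarith
  · rw [e]; nlinarith

lemma rises_block {β : ℝ} (hβ1 : 1 < β) (hβ : β ^ 3 = β ^ 2 + β + 1) {v y : ℝ}
    (hv : v < 1 - β⁻¹) (hy0 : 0 ≤ y) (hy1 : y < β⁻¹) (k : ℕ) :
    Rises β v (2 + 3 * k) (wordBranch β (block k) y) y := by
  have hb := inv_tribonacci_bounds hβ1 hβ
  induction k generalizing y with
  | zero => exact rises_word01 hβ1 hβ (by linarith) hy0 hy1
  | succ k ih =>
    rw [block_succ, wordBranch_append, mul_add, ← add_assoc]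
    refine (ih (wordBranch_nonneg hβ1 _ hy0) (wordBranch_word011_lt hβ1 hβ hy1)).trans ?_
      (rises_word011 hβ1 hβ (by linarith) hy0 hy1)
    rw [wordBranch_word011 hβ1 hβ]
    have : 0 < β⁻¹ ^ 3 := by positivity
    nlinarith

/-- Strictness between the endpoints gives minimality of the period: an earlier return to `v` would
lie strictly above `v`. -/
lemma Rises.mem_periodThresholds {β v : ℝ} {p : ℕ} (hv : v ∈ Ico (0 : ℝ) 1) (hp : 0 < p)
    (h : Rises β v p v v) : v ∈ periodThresholds β p := by
  have hper : Function.IsPeriodicPt (betaMap β) p v := h.1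
  refine ⟨hv, v, ⟨hv, fun n => ?_⟩, ?_⟩
  · rw [← hper.iterate_mod_apply n]
    rcases Nat.eq_zero_or_pos (n % p) with h0 | h0
    · simp [h0]
    · exact (h.2 _ h0 (Nat.mod_lt _ hp)).le
  · refine (hper.minimalPeriod_le hp).antisymm ?_
    by_contra! hlt
    have := h.2 _ (hper.minimalPeriod_pos hp) hlt
    rw [Function.iterate_minimalPeriod] at this
    exact this.false

/-! ### Decoding orbits without `00` into blocks -/

/-- `BlockChain β O ks y y'`: reading off blocks `01(011)^k`, `k ∈ ks`, leads from `y` to `y'`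
along points of `O` whose expansion starts with `010`. -/
def BlockChain (β : ℝ) (O : Set ℝ) : List ℕ → ℝ → ℝ → Prop
  | [], y, y' => y ∈ O ∧ y < 1 - β⁻¹ ∧ y = y'
  | k :: ks, y, y' => y ∈ O ∧ y < 1 - β⁻¹ ∧
      y = wordBranch β (block k) ((betaMap β)^[2 + 3 * k] y) ∧
      BlockChain β O ks ((betaMap β)^[2 + 3 * k] y) y'

lemma BlockChain.start {β : ℝ} {O : Set ℝ} {ks : List ℕ} {y y' : ℝ}
    (h : BlockChain β O ks y y') : y ∈ O ∧ y < 1 - β⁻¹ := by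
  cases ks with
  | nil => exact ⟨h.1, h.2.1⟩
  | cons k ks => exact ⟨h.1, h.2.1⟩

section Decode

variable {β : ℝ} {O : Set ℝ}

/-- A point starting with 0 must continue with 1, since 00 is excluded by the lower bound β⁻². After
01 the next digit decides between 01 followed by 0, and 011; the latter is followed by 0, since 111
would give a value of at least 1. -/
lemma first_block (hβ1 : 1 < β) (hβ2 : β < 2) (hβ : β ^ 3 = β ^ 2 + β + 1)
    (hT : ∀ y ∈ O, betaMap β y ∈ O)
    (hO : ∀ y ∈ O, β⁻¹ ^ 2 ≤ y ∧ y < 1) {y : ℝ} (hy : y ∈ O) (hyb : y < β⁻¹) :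
    β⁻¹ ≤ betaMap β y ∧
    (((betaMap β)^[2] y < β⁻¹ ∧ y < 1 - β⁻¹ ∧ y = wordBranch β word01 ((betaMap β)^[2] y)) ∨
    (β⁻¹ ≤ (betaMap β)^[2] y ∧ (betaMap β)^[3] y < β⁻¹ ∧ 1 - β⁻¹ ≤ y ∧
      y = wordBranch β word011 ((betaMap β)^[3] y))) := by
  obtain ⟨b1, b2, b3, b4, b5, b6⟩ := inv_tribonacci_bounds hβ1 hβ
  have hb := inv_tribonacci hβ1 hβ
  have m1 := hT _ hy
  have m2 := hT _ m1
  have m3 := hT _ m2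
  have e0 := eq_branch_zero hβ1 (by linarith [hO _ hy]) hyb
  have h1 : β⁻¹ ≤ betaMap β y := by
    have h := (hO _ hy).1
    rw [e0, branch_zero] at h
    nlinarith
  have e1 := eq_branch_one hβ1 hβ2 (hO _ m1).2 h1
  refine ⟨h1, ?_⟩
  simp only [Function.iterate_succ, Function.iterate_zero, Function.comp_apply, id]
  rcases lt_or_ge (betaMap β (betaMap β y)) β⁻¹ with h2 | h2
  · have e : y = wordBranch β word01 (betaMap β (betaMap β y)) := by
      conv_lhs => rw [e0, e1]
      rfl
    refine Or.inl ⟨h2, ?_, e⟩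
    rw [e]
    exact wordBranch_block_lt hβ1 hβ 0 h2
  · have e2 := eq_branch_one hβ1 hβ2 (hO _ m2).2 h2
    have e : y = wordBranch β word011 (betaMap β (betaMap β (betaMap β y))) := by
      conv_lhs => rw [e0, e1, e2]
      rfl
    refine Or.inr ⟨h2, ?_, ?_, e⟩
    · by_contra! h3
      have h := (hO _ m1).2
      rw [e1, branch_one, e2, branch_one] at h
      have : 0 < β⁻¹ ^ 2 := by positivity
      nlinarith
    · rw [e, wordBranch_word011 hβ1 hβ]
      have h0 : 0 < β⁻¹ ^ 3 := by positivity
      have := (betaMap_mem β (betaMap β (betaMap β y))).1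
      nlinarith

/-- Here `k` counts the words 011 read before the first 01; prepending a further 01 turns them into
the block `01(011)^k`. The hypothesis on the endpoint ensures that the reading stops at the start of
a block, not inside a word. -/
lemma exists_blockChain_of_lt (hβ1 : 1 < β) (hβ2 : β < 2) (hβ : β ^ 3 = β ^ 2 + β + 1)
    (hT : ∀ y ∈ O, betaMap β y ∈ O)
    (hO : ∀ y ∈ O, β⁻¹ ^ 2 ≤ y ∧ y < 1) (N : ℕ) {y : ℝ} (hy : y ∈ O) (hyb : y < β⁻¹)
    (hN : (betaMap β)^[N] y < 1 - β⁻¹) :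
    ∃ k ks, 3 * k + (2 * ks.length + 3 * ks.sum) = N ∧
      y = wordBranch β (wordPow word011 k) ((betaMap β)^[3 * k] y) ∧
      BlockChain β O ks ((betaMap β)^[3 * k] y) ((betaMap β)^[N] y) := by
  induction N using Nat.strong_induction_on generalizing y with
  | _ N ih =>
    obtain ⟨b1, b2, b3, b4, b5, b6⟩ := inv_tribonacci_bounds hβ1 hβ
    have m2 : (betaMap β)^[2] y ∈ O := hT _ (hT _ hy)
    have m3 : (betaMap β)^[3] y ∈ O := hT _ (hT _ (hT _ hy))
    obtain ⟨h1, h | h⟩ := first_block hβ1 hβ2 hβ hT hO hy hyb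
    · obtain ⟨h2, hA, e⟩ := h
      rcases N with _ | _ | N
      · exact ⟨0, [], by simp, by simp, hy, hA, rfl⟩
      · simp only [zero_add, Function.iterate_one] at hN; linarith
      · rw [Function.iterate_add_apply (betaMap β) N 2] at hN
        obtain ⟨k, ks, hs, ek, hc⟩ := ih N (by omega) m2 h2 hN
        rw [← Function.iterate_add_apply, ← Function.iterate_add_apply] at hc
        rw [← Function.iterate_add_apply] at ek
        refine ⟨0, k :: ks, ?_, by simp, hy, hA, ?_, ?_⟩
        · simp only [List.length_cons, List.sum_cons]; omega
        · rw [block, wordBranch_append, mul_zero, Function.iterate_zero, id, add_comm 2, ← ek]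
          exact e
        · rw [mul_zero, Function.iterate_zero, id, add_comm 2]
          exact hc
    · obtain ⟨h2, h3, hB, e⟩ := h
      rcases N with _ | _ | _ | N
      · simp only [Function.iterate_zero, id] at hN; linarith
      · simp only [zero_add, Function.iterate_one] at hN; linarith
      · simp only [zero_add, Nat.reduceAdd] at hN; linarith
      · rw [Function.iterate_add_apply (betaMap β) N 3] at hN
        obtain ⟨k, ks, hs, ek, hc⟩ := ih N (by omega) m3 h3 hN
        rw [← Function.iterate_add_apply, ← Function.iterate_add_apply] at hc
        rw [← Function.iterate_add_apply] at ek
        refine ⟨k + 1, ks, by omega, ?_, hc⟩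
        rw [wordPow_succ, wordBranch_append, mul_add, mul_one, ← ek]
        exact e

/-- An orbit needs a digit 0, since 111 is impossible. If 010 never occurred, a point `y < β⁻¹`
would be coded by a power of 011 over a multiple of its period, hence would equal the fixed point
β⁻¹. -/
lemma exists_lt_of_orbit (hβ1 : 1 < β) (hβ2 : β < 2) (hβ : β ^ 3 = β ^ 2 + β + 1)
    (hT : ∀ y ∈ O, betaMap β y ∈ O)
    (hO : ∀ y ∈ O, β⁻¹ ^ 2 ≤ y ∧ y < 1) {p : ℕ} (hp : 0 < p)
    (hper : ∀ y ∈ O, (betaMap β)^[p] y = y) (hne : O.Nonempty) : ∃ y ∈ O, y < 1 - β⁻¹ := by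
  obtain ⟨b1, b2, b3, b4, b5, b6⟩ := inv_tribonacci_bounds hβ1 hβ
  have hb := inv_tribonacci hβ1 hβ
  by_contra! hall
  obtain ⟨y, hy, hyb⟩ : ∃ y ∈ O, y < β⁻¹ := by
    by_contra! hge
    obtain ⟨y, hy⟩ := hne
    have m1 := hT _ hy
    have m2 := hT _ m1
    have h0 := (hO _ hy).2
    have h3 := (betaMap_mem β (betaMap β (betaMap β y))).1
    rw [eq_branch_one hβ1 hβ2 (hO _ hy).2 (hge _ hy),
      eq_branch_one hβ1 hβ2 (hO _ m1).2 (hge _ m1),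
      eq_branch_one hβ1 hβ2 (hO _ m2).2 (hge _ m2)] at h0
    simp only [branch_one] at h0
    have : 0 < β⁻¹ ^ 3 := by positivity
    nlinarith
  have key : ∀ n, (betaMap β)^[3 * n] y ∈ O ∧ (betaMap β)^[3 * n] y < β⁻¹ ∧
      y = wordBranch β (wordPow word011 n) ((betaMap β)^[3 * n] y) := by
    intro n
    induction n with
    | zero => exact ⟨hy, hyb, by simp⟩
    | succ n ih =>
      obtain ⟨i1, i2, i3⟩ := ih
      rw [mul_add, mul_one, add_comm, Function.iterate_add_apply]
      obtain ⟨-, h | h⟩ := first_block hβ1 hβ2 hβ hT hO i1 i2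
      · linarith [hall _ i1]
      · refine ⟨hT _ (hT _ (hT _ i1)), h.2.1, ?_⟩
        rw [wordPow_add, wordBranch_append, wordPow_succ, wordPow_zero, List.append_nil,
          ← h.2.2.2]
        exact i3
  have h := (key p).2.2
  have hper3 : (betaMap β)^[3 * p] y = y :=
    ((show Function.IsPeriodicPt (betaMap β) p y from hper y hy).const_mul 3)
  rw [hper3] at h
  have hfix : ∀ n, β⁻¹ = wordBranch β (wordPow word011 n) β⁻¹ := by
    intro n
    induction n with
    | zero => simp
    | succ n ih =>
      rw [wordPow_succ, wordBranch_append, ← ih, wordBranch_word011 hβ1 hβ]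
      linear_combination (1 - β⁻¹) * hb
  refine hyb.ne (eq_of_wordBranch_eq hβ1 ?_ h (hfix p))
  intro h0
  have := length_wordPow word011 p
  rw [h0] at this
  simp [word011] at this
  omega

/-- A block with exponent below `l` would start at an orbit point below `v`. Summing the exponents
gives the inequality that limits the number of blocks. -/
lemma BlockChain.forall_le (hβ1 : 1 < β) (hβ : β ^ 3 = β ^ 2 + β + 1) {v v' : ℝ} {l : ℕ}
    (hO : ∀ y ∈ O, v < y) (hv : v = wordBranch β (block l) v') (hv' : 0 ≤ v') {ks : List ℕ}
    {y y' : ℝ} (h : BlockChain β O ks y y') : ks.length * l ≤ ks.sum := by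
  induction ks generalizing y with
  | nil => simp
  | cons k ks ih =>
    obtain ⟨h1, h2, h3, h4⟩ := h
    have hlk : l ≤ k := by
      by_contra! hlt
      have := block_lt_block hβ1 hβ hlt h4.start.2 hv'
      rw [← hv, ← h3] at this
      exact this.not_gt (hO _ h1)
    have := ih h4
    simp only [List.length_cons, List.sum_cons, add_mul]
    omega

end Decode

/-! ### Comparison with a lower bound and closed chains -/

/-- Lexicographic comparison of a point with a point below it. -/
lemma block_compare {β : ℝ} (hβ1 : 1 < β) (hβ : β ^ 3 = β ^ 2 + β + 1) {v v' y y' : ℝ} {k l : ℕ}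
    (hv : v = wordBranch β (block l) v') (hv' : 0 ≤ v') (hy : y = wordBranch β (block k) y')
    (hy' : y' < 1 - β⁻¹) (hvy : v < y) : l < k ∨ (k = l ∧ v' < y') := by
  rcases lt_trichotomy l k with h | rfl | h
  · exact Or.inl h
  · rw [hv, hy] at hvy
    exact Or.inr ⟨rfl, (wordBranch_strictMono hβ1 _).lt_iff_lt.1 hvy⟩
  · have := block_lt_block hβ1 hβ h hy' hv'
    rw [← hv, ← hy] at this
    exact absurd hvy this.not_gt

/-- The closed block chain of a periodic orbit lying above `v`, where `v` starts with a block. -/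
lemma exists_blockChain {β : ℝ} (hβ1 : 1 < β) (hβ2 : β < 2) (hβ : β ^ 3 = β ^ 2 + β + 1)
    {x v : ℝ} {p : ℕ} (hp : 0 < p) (hx : x ∈ Ico (0 : ℝ) 1)
    (hmin : Function.minimalPeriod (betaMap β) x = p) (hxv : ∀ n, v < (betaMap β)^[n] x)
    (hb : ∀ n, β⁻¹ ^ 2 ≤ (betaMap β)^[n] x) :
    ∃ (O : Set ℝ) (y : ℝ) (ks : List ℕ),
      (∀ u ∈ O, v < u ∧ Function.minimalPeriod (betaMap β) u = p) ∧
      BlockChain β O ks y y ∧ 2 * ks.length + 3 * ks.sum = p := by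
  let O : Set ℝ := Set.range fun n => (betaMap β)^[n] x
  have hT : ∀ y ∈ O, betaMap β y ∈ O := by
    rintro _ ⟨n, rfl⟩
    exact ⟨n + 1, Function.iterate_succ_apply' _ _ _⟩
  have hO : ∀ y ∈ O, β⁻¹ ^ 2 ≤ y ∧ y < 1 := by
    rintro _ ⟨n, rfl⟩
    exact ⟨hb n, (iterate_betaMap_mem β hx n).2⟩
  have hmem : x ∈ Function.periodicPts (betaMap β) :=
    Function.minimalPeriod_pos_iff_mem_periodicPts.1 (by omega)
  have hmin' : ∀ y ∈ O, Function.minimalPeriod (betaMap β) y = p := by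
    rintro _ ⟨n, rfl⟩
    exact (Function.minimalPeriod_apply_iterate hmem n).trans hmin
  have hper : ∀ y ∈ O, (betaMap β)^[p] y = y := by
    intro y hy
    rw [← hmin' y hy]; exact Function.iterate_minimalPeriod
  obtain ⟨y, hy, hyA⟩ := exists_lt_of_orbit hβ1 hβ2 hβ hT hO hp hper ⟨x, 0, rfl⟩
  have hbd := inv_tribonacci_bounds hβ1 hβ
  obtain ⟨k, ks, hs, ek, hc⟩ := exists_blockChain_of_lt hβ1 hβ2 hβ hT hO p hy (by linarith)
    (by rwa [hper y hy])
  rcases k with _ | k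
  · rw [hper y hy] at hc
    exact ⟨O, y, ks, fun u hu => ⟨by obtain ⟨n, rfl⟩ := hu; exact hxv n, hmin' u hu⟩, hc,
      by omega⟩
  -- The chain starts at a point below 1 - β⁻¹, so it cannot begin with 011.
  · exfalso
    rw [wordPow_succ, wordBranch_append, wordBranch_word011 hβ1 hβ] at ek
    have h0 := (hO _ hc.start.1).1
    have := wordBranch_nonneg hβ1 (wordPow word011 k) (hbd.2.2.2.2.2.le.trans h0)
    have h3 : 0 < β⁻¹ ^ 3 := by positivity
    nlinarith

/-- A chain of equal blocks comes from a point whose period is the length of the block. -/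
lemma minimalPeriod_le_of_block {β : ℝ} (hβ1 : 1 < β) {y : ℝ} {k : ℕ} {w : List (Fin 2)}
    (hw : w ≠ []) (hy : y = wordBranch β w y)
    -- Commutation makes the `block k` image of `y` another fixed point of the branch of `w`, hence
    -- equal to `y`.
    (hcomm : ∀ t, wordBranch β w (wordBranch β (block k) t) =
      wordBranch β (block k) (wordBranch β w t))
    (hk : y = wordBranch β (block k) ((betaMap β)^[2 + 3 * k] y)) :
    Function.minimalPeriod (betaMap β) y ≤ 2 + 3 * k := by
  have h1 : y = wordBranch β (block k) y :=
    eq_of_wordBranch_eq hβ1 hw hy (by rw [hcomm, ← hy])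
  have h2 := (wordBranch_strictMono hβ1 _).injective (h1.symm.trans hk)
  exact Function.IsPeriodicPt.minimalPeriod_le (by omega) h2.symm

/-- A threshold exceeding `v` would put a whole orbit strictly above `v`, so maximality reduces to
excluding such orbits. -/
lemma isGreatest_periodThresholds {β v : ℝ} {p : ℕ} (hv : v ∈ periodThresholds β p)
    (h : ∀ x ∈ Ico (0 : ℝ) 1, Function.minimalPeriod (betaMap β) x = p →
      (∀ n, v < (betaMap β)^[n] x) → False) : IsGreatest (periodThresholds β p) v := by
  refine ⟨hv, fun t ht => ?_⟩
  obtain ⟨-, x, ⟨hx, hxt⟩, hmin⟩ := ht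
  by_contra! hlt
  exact h x hx hmin fun n => hlt.trans_le (hxt n)

/-! ### Periods `p ≥ 2` with an extremal word made of blocks -/

section Blocks

variable {β : ℝ}

lemma block_ne_nil (k : ℕ) (w : List (Fin 2)) : block k ++ w ≠ [] := by simp [block, word01]

lemma lt_of_eq_block (hβ1 : 1 < β) (hβ : β ^ 3 = β ^ 2 + β + 1) {v : ℝ} (ks : List ℕ) (k : ℕ)
    (hv : v = wordBranch β (block k ++ (ks.map block).flatten) v) : v < 1 - β⁻¹ := by
  have hbd := inv_tribonacci_bounds hβ1 hβ
  refine lt_of_wordBranch_lt hβ1 (block_ne_nil _ _) hv ?_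
  rw [wordBranch_append]
  refine wordBranch_block_lt hβ1 hβ k ?_
  clear hv
  induction ks with
  | nil => simpa using hbd.1
  | cons l ks ih =>
    rw [List.map_cons, List.flatten_cons, wordBranch_append]
    exact (wordBranch_block_lt hβ1 hβ l ih).trans hbd.1

lemma mem_periodThresholds_one_block (hβ1 : 1 < β) (hβ : β ^ 3 = β ^ 2 + β + 1) {v : ℝ} {k : ℕ}
    (hv0 : 0 ≤ v) (hv : v = wordBranch β (block k) v) :
    v ∈ periodThresholds β (2 + 3 * k) := by
  have hbd := inv_tribonacci_bounds hβ1 hβ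
  have hA := lt_of_eq_block hβ1 hβ [] k (by simpa using hv)
  have h := rises_block hβ1 hβ hA hv0 (by linarith) k
  rw [← hv] at h
  exact h.mem_periodThresholds ⟨hv0, by linarith⟩ (by omega)

lemma mem_periodThresholds_two_blocks (hβ1 : 1 < β) (hβ : β ^ 3 = β ^ 2 + β + 1) {v v₁ : ℝ}
    {k l : ℕ} (hv0 : 0 ≤ v) (hv : v = wordBranch β (block k) v₁)
    (hv₁ : v₁ = wordBranch β (block l) v) (h1 : v < v₁) :
    v ∈ periodThresholds β (2 + 3 * k + (2 + 3 * l)) := by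
  have hbd := inv_tribonacci_bounds hβ1 hβ
  have hA := lt_of_eq_block hβ1 hβ (v := v) [l] k (by simpa [wordBranch_append, ← hv₁] using hv)
  have hA₁ := wordBranch_block_lt hβ1 hβ l (hA.trans hbd.1)
  rw [← hv₁] at hA₁
  have r1 := rises_block hβ1 hβ hA (hv0.trans h1.le) (hA₁.trans hbd.1) k
  have r2 := rises_block hβ1 hβ hA hv0 (hA.trans hbd.1) l
  rw [← hv] at r1
  rw [← hv₁] at r2
  exact (r1.trans h1 r2).mem_periodThresholds ⟨hv0, by linarith⟩ (by omega)

lemma mem_periodThresholds_three_blocks (hβ1 : 1 < β) (hβ : β ^ 3 = β ^ 2 + β + 1)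
    {v v₁ v₂ : ℝ} {k l m : ℕ} (hv0 : 0 ≤ v) (hv : v = wordBranch β (block k) v₁)
    (hv₁ : v₁ = wordBranch β (block l) v₂) (hv₂ : v₂ = wordBranch β (block m) v)
    (h1 : v < v₁) (h2 : v < v₂) :
    v ∈ periodThresholds β (2 + 3 * k + (2 + 3 * l + (2 + 3 * m))) := by
  have hbd := inv_tribonacci_bounds hβ1 hβ
  have hA := lt_of_eq_block hβ1 hβ (v := v) [l, m] k
    (by simpa [wordBranch_append, ← hv₂, ← hv₁] using hv)
  have hA₂ := wordBranch_block_lt hβ1 hβ m (hA.trans hbd.1)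
  rw [← hv₂] at hA₂
  have hA₁ := wordBranch_block_lt hβ1 hβ l (hA₂.trans hbd.1)
  rw [← hv₁] at hA₁
  have r1 := rises_block hβ1 hβ hA (hv0.trans h1.le) (hA₁.trans hbd.1) k
  have r2 := rises_block hβ1 hβ hA (hv0.trans h2.le) (hA₂.trans hbd.1) l
  have r3 := rises_block hβ1 hβ hA hv0 (hA.trans hbd.1) m
  rw [← hv] at r1
  rw [← hv₁] at r2
  rw [← hv₂] at r3
  exact (r1.trans h1 (r2.trans h2 r3)).mem_periodThresholds ⟨hv0, by linarith⟩ (by omega)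

/-- `exists_blockChain` for a lower bound `v` whose expansion starts with the block `01(011)^l`. -/
lemma exists_blockChain_above (hβ1 : 1 < β) (hβ2 : β < 2) (hβ : β ^ 3 = β ^ 2 + β + 1)
    {x v v' : ℝ} {p l : ℕ} (hp : 0 < p) (hv : v = wordBranch β (block l) v') (hv' : 0 ≤ v')
    (hx : x ∈ Ico (0 : ℝ) 1) (hmin : Function.minimalPeriod (betaMap β) x = p)
    (hxv : ∀ n, v < (betaMap β)^[n] x) :
    ∃ (O : Set ℝ) (y : ℝ) (ks : List ℕ),
      (∀ u ∈ O, v < u ∧ Function.minimalPeriod (betaMap β) u = p) ∧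
      BlockChain β O ks y y ∧ 2 * ks.length + 3 * ks.sum = p ∧ ks.length * l ≤ ks.sum := by
  have hb : β⁻¹ ^ 2 ≤ v := by rw [hv]; exact le_wordBranch_block hβ1 l hv'
  obtain ⟨O, y, ks, hO, hc, hs⟩ := exists_blockChain hβ1 hβ2 hβ hp hx hmin hxv
    fun n => hb.trans (hxv n).le
  exact ⟨O, y, ks, hO, hc, hs, hc.forall_le hβ1 hβ (fun u hu => (hO u hu).1) hv hv'⟩

lemma isGreatest_one_block (hβ1 : 1 < β) (hβ2 : β < 2) (hβ : β ^ 3 = β ^ 2 + β + 1) {v : ℝ}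
    {k : ℕ} (hv0 : 0 ≤ v) (hv : v = wordBranch β (block k) v) :
    IsGreatest (periodThresholds β (2 + 3 * k)) v := by
  refine isGreatest_periodThresholds (mem_periodThresholds_one_block hβ1 hβ hv0 hv) ?_
  intro x hx hmin hxv
  obtain ⟨O, y, ks, hO, hc, hs, hl⟩ :=
    exists_blockChain_above hβ1 hβ2 hβ (by omega) hv hv0 hx hmin hxv
  match ks with
  | [] => simp only [List.length_nil, List.sum_nil] at hs; omega
  -- With r ≥ 2 blocks, all exponents at least `k`, the length is at least 4 + 6k, more than 2 + 3k.
  | a :: b :: ks =>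
    simp only [List.length_cons] at hs hl
    nlinarith
  | [a] =>
    obtain ⟨h1, h2, h3, h4, h5, h6⟩ := hc
    simp only [List.length_cons, List.sum_cons, List.length_nil, List.sum_nil] at hs
    obtain rfl : a = k := by omega
    rw [h6] at h3
    have := eq_of_wordBranch_eq hβ1 (by simpa using block_ne_nil a []) hv h3
    exact (hO _ h1).1.ne this

lemma not_two_equal_blocks (hβ1 : 1 < β) {y y₁ : ℝ} {k : ℕ}
    (hmin : Function.minimalPeriod (betaMap β) y = 2 + 3 * k + (2 + 3 * k))
    (hy₁ : y₁ = (betaMap β)^[2 + 3 * k] y)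
    (h : y = wordBranch β (block k) y₁) (h1 : y₁ = wordBranch β (block k) y) : False := by
  have := minimalPeriod_le_of_block hβ1 (y := y) (k := k) (w := block k ++ block k)
    (block_ne_nil _ _) (by rw [wordBranch_append, ← h1, ← h])
    (fun t => by simp only [wordBranch_append]) (by rwa [← hy₁])
  omega

lemma not_three_equal_blocks (hβ1 : 1 < β) {y y₁ y₂ : ℝ} {k : ℕ}
    (hmin : Function.minimalPeriod (betaMap β) y = 2 + 3 * k + (2 + 3 * k + (2 + 3 * k)))
    (hy₁ : y₁ = (betaMap β)^[2 + 3 * k] y)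
    (h : y = wordBranch β (block k) y₁) (h1 : y₁ = wordBranch β (block k) y₂)
    (h2 : y₂ = wordBranch β (block k) y) : False := by
  have := minimalPeriod_le_of_block hβ1 (y := y) (k := k) (w := block k ++ (block k ++ block k))
    (block_ne_nil _ _) (by rw [wordBranch_append, wordBranch_append, ← h2, ← h1, ← h])
    (fun t => by simp only [wordBranch_append]) (by rwa [← hy₁])
  omega

lemma eq_of_two_blocks (hβ1 : 1 < β) {v v₁ y y₁ : ℝ} {k l : ℕ}
    (hv : v = wordBranch β (block k) v₁) (hv₁ : v₁ = wordBranch β (block l) v)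
    (hy : y = wordBranch β (block k) y₁) (hy₁ : y₁ = wordBranch β (block l) y) : v = y :=
  eq_of_wordBranch_eq hβ1 (block_ne_nil k (block l)) (by rw [wordBranch_append, ← hv₁, ← hv])
    (by rw [wordBranch_append, ← hy₁, ← hy])

lemma eq_of_three_blocks (hβ1 : 1 < β) {v v₁ v₂ y y₁ y₂ : ℝ} {k l m : ℕ}
    (hv : v = wordBranch β (block k) v₁) (hv₁ : v₁ = wordBranch β (block l) v₂)
    (hv₂ : v₂ = wordBranch β (block m) v)
    (hy : y = wordBranch β (block k) y₁) (hy₁ : y₁ = wordBranch β (block l) y₂)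
    (hy₂ : y₂ = wordBranch β (block m) y) : v = y :=
  eq_of_wordBranch_eq hβ1 (block_ne_nil k (block l ++ block m))
    (by rw [wordBranch_append, wordBranch_append, ← hv₂, ← hv₁, ← hv])
    (by rw [wordBranch_append, wordBranch_append, ← hy₂, ← hy₁, ← hy])

/-- The extremal words with two blocks. -/
lemma isGreatest_two_blocks (hβ1 : 1 < β) (hβ2 : β < 2) (hβ : β ^ 3 = β ^ 2 + β + 1) {v v₁ : ℝ}
    {k l : ℕ} (hv0 : 0 ≤ v) (hv : v = wordBranch β (block k) v₁)
    (hv₁ : v₁ = wordBranch β (block l) v) (hl : l = k + 1 ∨ l = k + 2) :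
    IsGreatest (periodThresholds β (2 + 3 * k + (2 + 3 * l))) v := by
  have hbd := inv_tribonacci_bounds hβ1 hβ
  have hA := lt_of_eq_block hβ1 hβ (v := v) [l] k (by simpa [wordBranch_append, ← hv₁] using hv)
  have hA₁ := wordBranch_block_lt hβ1 hβ l (hA.trans hbd.1)
  rw [← hv₁] at hA₁
  have hlt : v < v₁ := by
    have := block_lt_block hβ1 hβ (show k < l by omega) hA₁ hv0
    rwa [← hv, ← hv₁] at this
  have hv₁0 := hv0.trans hlt.le
  refine isGreatest_periodThresholds (mem_periodThresholds_two_blocks hβ1 hβ hv0 hv hv₁ hlt) ?_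
  intro x hx hmin hxv
  obtain ⟨O, y, ks, hO, hc, hs, hle⟩ :=
    exists_blockChain_above hβ1 hβ2 hβ (by omega) hv hv₁0 hx hmin hxv
  -- Lexicographic comparison with the exponent sequence of `v`, truncated after one period of it.
  have cmp : ∀ {a b : ℕ} {u u' u'' : ℝ}, u ∈ O → u = wordBranch β (block a) u' →
      u' < 1 - β⁻¹ → u' = wordBranch β (block b) u'' → u'' < 1 - β⁻¹ → k ≤ a ∧ (a = k → l ≤ b) := by
    intro a b u u' u'' hu h h' h1 h1'
    rcases block_compare hβ1 hβ hv hv₁0 h h' (hO u hu).1 with h2 | ⟨h2', h2⟩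
    · omega
    · rcases block_compare hβ1 hβ hv₁ hv0 h1 h1' h2 with h3 | ⟨h3, -⟩ <;> omega
  match ks with
  | [] => simp only [List.length_nil, List.sum_nil] at hs; omega
  | [a] =>
    simp only [List.length_cons, List.sum_cons, List.length_nil, List.sum_nil] at hs
    omega
  | [a, b] =>
    obtain ⟨h1, h2, h3, h4, h5, h6, h7, h8, h9⟩ := hc
    simp only [List.length_cons, List.sum_cons, List.length_nil, List.sum_nil] at hs
    rw [h9] at h6
    have c1 := cmp h1 h3 h5 h6 h2
    have c2 := cmp h4 h6 h2 h3 h5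
    have n1 : ¬(a = k ∧ b = l) := by
      rintro ⟨rfl, rfl⟩
      exact (hO _ h1).1.ne (eq_of_two_blocks hβ1 hv hv₁ h3 h6)
    have n2 : ¬(b = k ∧ a = l) := by
      rintro ⟨rfl, rfl⟩
      exact (hO _ h4).1.ne (eq_of_two_blocks hβ1 hv hv₁ h6 h3)
    have n3 : ¬(a = b) := by
      rintro rfl
      exact not_two_equal_blocks hβ1 (by rw [(hO _ h1).2]; omega) rfl h3 h6
    -- The exponents sum to `k + l`. Apart from the rotations of `(k, l)`, only the pair `(k + 1, k
    -- + 1)` has both entries at least `k`; it occurs for `l = k + 2` and is not primitive.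
    omega
  | a :: b :: c :: ks =>
    have hks : ks.length ≤ 2 := by
      by_contra! hks
      simp only [List.length_cons] at hs hle
      have h6 : 6 ≤ ks.length + 1 + 1 + 1 := by omega
      have := Nat.mul_le_mul_right k h6
      omega
    obtain ⟨h1, h2, h3, h4, h5, h6, h7⟩ := hc
    have c1 := cmp h1 h3 h5 h6 h7.start.2
    simp only [List.length_cons, List.sum_cons] at hs hle
    generalize ks.length = r at hs hle hks
    -- Three or four blocks fail modulo 3. Five blocks force `k = 0`, `l = 2` and all exponents 0,
    -- against `c1`.
    interval_cases r <;> omega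

/-- The extremal words with three blocks. -/
lemma isGreatest_three_blocks (hβ1 : 1 < β) (hβ2 : β < 2) (hβ : β ^ 3 = β ^ 2 + β + 1)
    {v v₁ v₂ : ℝ} {k l m : ℕ} (hv0 : 0 ≤ v) (hv : v = wordBranch β (block k) v₁)
    (hv₁ : v₁ = wordBranch β (block l) v₂) (hv₂ : v₂ = wordBranch β (block m) v)
    (hm : m = k + 1) (hl : k ≤ l) (hl2 : l ≤ k + 2) :
    IsGreatest (periodThresholds β (2 + 3 * k + (2 + 3 * l + (2 + 3 * m)))) v := by
  have hbd := inv_tribonacci_bounds hβ1 hβ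
  have hA := lt_of_eq_block hβ1 hβ (v := v) [l, m] k
    (by simpa [wordBranch_append, ← hv₂, ← hv₁] using hv)
  have hA₂ := wordBranch_block_lt hβ1 hβ m (hA.trans hbd.1)
  rw [← hv₂] at hA₂
  have hA₁ := wordBranch_block_lt hβ1 hβ l (hA₂.trans hbd.1)
  rw [← hv₁] at hA₁
  have hlt₂ : v < v₂ := by
    have := block_lt_block hβ1 hβ (show k < m by omega) hA₁ hv0
    rwa [← hv, ← hv₂] at this
  have hv₂0 := hv0.trans hlt₂.le
  have hlt : v < v₁ := by
    -- If `l = k` the first blocks of `v` and `v₁` agree, and the comparison is decided one block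
    -- later by `k < m`.
    rcases hl.eq_or_lt with rfl | hkl
    · have := block_lt_block hβ1 hβ (show k < m by omega) hA₂ hv0
      rw [← hv₁, ← hv₂] at this
      conv_lhs => rw [hv]
      conv_rhs => rw [hv₁]
      exact wordBranch_strictMono hβ1 _ this
    · have := block_lt_block hβ1 hβ hkl hA₁ hv₂0
      rwa [← hv, ← hv₁] at this
  have hv₁0 := hv0.trans hlt.le
  refine isGreatest_periodThresholds
    (mem_periodThresholds_three_blocks hβ1 hβ hv0 hv hv₁ hv₂ hlt hlt₂) ?_
  intro x hx hmin hxv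
  obtain ⟨O, y, ks, hO, hc, hs, hle⟩ :=
    exists_blockChain_above hβ1 hβ2 hβ (by omega) hv hv₁0 hx hmin hxv
  have cmp : ∀ {a b c : ℕ} {u u' u'' u''' : ℝ}, u ∈ O → u = wordBranch β (block a) u' →
      u' < 1 - β⁻¹ → u' = wordBranch β (block b) u'' → u'' < 1 - β⁻¹ →
      u'' = wordBranch β (block c) u''' → u''' < 1 - β⁻¹ →
      k ≤ a ∧ (a = k → l ≤ b ∧ (b = l → m ≤ c)) := by
    intro a b c u u' u'' u''' hu h h' h1 h1' h2 h2'
    rcases block_compare hβ1 hβ hv hv₁0 h h' (hO u hu).1 with g | ⟨g, g'⟩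
    · omega
    · rcases block_compare hβ1 hβ hv₁ hv₂0 h1 h1' g' with i | ⟨i, i'⟩
      · omega
      · rcases block_compare hβ1 hβ hv₂ hv0 h2 h2' i' with j | ⟨j, -⟩ <;> omega
  match ks with
  | [] => simp only [List.length_nil, List.sum_nil] at hs; omega
  | [a] =>
    simp only [List.length_cons, List.sum_cons, List.length_nil, List.sum_nil] at hs
    omega
  | [a, b] =>
    simp only [List.length_cons, List.sum_cons, List.length_nil, List.sum_nil] at hs
    omega
  | [a, b, c] =>
    obtain ⟨h1, h2, h3, h4, h5, h6, h7, h8, h9, h10, h11, h12⟩ := hc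
    simp only [List.length_cons, List.sum_cons, List.length_nil, List.sum_nil] at hs
    rw [h12] at h9
    have c1 := cmp h1 h3 h5 h6 h8 h9 h2
    have c2 := cmp h4 h6 h8 h9 h2 h3 h5
    have c3 := cmp h7 h9 h2 h3 h5 h6 h8
    have n1 : ¬(a = k ∧ b = l ∧ c = m) := by
      rintro ⟨rfl, rfl, rfl⟩
      exact (hO _ h1).1.ne (eq_of_three_blocks hβ1 hv hv₁ hv₂ h3 h6 h9)
    have n2 : ¬(b = k ∧ c = l ∧ a = m) := by
      rintro ⟨rfl, rfl, rfl⟩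
      exact (hO _ h4).1.ne (eq_of_three_blocks hβ1 hv hv₁ hv₂ h6 h9 h3)
    have n3 : ¬(c = k ∧ a = l ∧ b = m) := by
      rintro ⟨rfl, rfl, rfl⟩
      exact (hO _ h7).1.ne (eq_of_three_blocks hβ1 hv hv₁ hv₂ h9 h3 h6)
    have n4 : ¬(a = b ∧ b = c) := by
      rintro ⟨rfl, rfl⟩
      exact not_three_equal_blocks hβ1 (by rw [(hO _ h1).2]; omega) rfl h3 h6 h9
    -- Exponents at least `k` with sum `k + l + m` leave the rotations of `(k, l, m)`, the constant
    -- triple (when `l = k + 2`), and triples with a rotation starting with `k` followed by an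
    -- exponent below `l`, which `c1`, `c2`, `c3` exclude.
    omega
  | a :: b :: c :: d :: ks =>
    have hks : ks.length ≤ 2 := by
      by_contra! hks
      simp only [List.length_cons] at hs hle
      have h7 : 7 ≤ ks.length + 1 + 1 + 1 + 1 := by omega
      have := Nat.mul_le_mul_right k h7
      omega
    obtain ⟨h1, h2, h3, h4, h5, h6, h7, h8, h9, h10⟩ := hc
    have c1 := cmp h1 h3 h5 h6 h8 h9 h10.start.2
    -- Four or five blocks fail modulo 3. Six blocks force `k = 0` and exponent sum `l - 1 ≤ 1`;
    -- comparing at the first two boundaries, `c1` and `c2`, then gives a contradiction.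
    match ks with
    | [] =>
      simp only [List.length_cons, List.sum_cons, List.length_nil, List.sum_nil] at hs hle
      omega
    | [e] =>
      simp only [List.length_cons, List.sum_cons, List.length_nil, List.sum_nil] at hs hle
      omega
    | e :: f :: ks =>
      obtain ⟨-, h11, h12, h13⟩ := h10
      have c2 := cmp h4 h6 h8 h9 h11 h12 h13.start.2
      simp only [List.length_cons] at hks
      obtain rfl : ks = [] := List.length_eq_zero_iff.1 (by omega)
      simp only [List.length_cons, List.sum_cons, List.length_nil, List.sum_nil] at hs hle
      omega

end Blocks

/-! ### The remaining periods -/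

section Small

variable {β : ℝ}

lemma isGreatest_period_one (hβ1 : 1 < β) (hβ2 : β < 2) :
    IsGreatest (periodThresholds β 1) 0 := by
  have h0 : Rises β 0 1 0 0 := by
    simpa [branch_zero] using rises_branch hβ1 0 0 (x := 0) le_rfl one_pos
  refine isGreatest_periodThresholds (h0.mem_periodThresholds (by simp) one_pos) ?_
  intro x hx hmin hxv
  have hfix : betaMap β x = x := by
    have := Function.iterate_minimalPeriod (f := betaMap β) (x := x)
    rwa [hmin, Function.iterate_one] at this
  have hx0 : 0 < x := hxv 0
  have hb0 : 0 < β⁻¹ := by positivity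
  have hb1 : β⁻¹ < 1 := inv_lt_one_of_one_lt₀ hβ1
  have hb2 : 2⁻¹ < β⁻¹ := (inv_lt_inv₀ (by norm_num) (by linarith)).2 hβ2
  have hx1 := hx.2
  rcases lt_or_ge x β⁻¹ with h | h
  · have := eq_branch_zero hβ1 hx0.le h
    rw [hfix, branch_zero] at this
    nlinarith
  · have := eq_branch_one hβ1 hβ2 hx.2 h
    rw [hfix, branch_one] at this
    nlinarith

lemma lt_sq_of_eq_branch_zero (hβ1 : 1 < β) {v u : ℝ} (hv : v = branch β 0 u) (hu : u < β⁻¹) :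
    v < β⁻¹ ^ 2 := by
  have : 0 < β⁻¹ := by positivity
  rw [hv, branch_zero, sq]
  exact mul_lt_mul_of_pos_left hu this

lemma lt_of_branch_lt_branch (hβ1 : 1 < β) {d : Fin 2} {x y : ℝ}
    (h : branch β d x < branch β d y) : x < y :=
  (wordBranch_strictMono hβ1 [d]).lt_iff_lt.1 h

lemma le_branch_one (hβ1 : 1 < β) {x : ℝ} (hx : 0 ≤ x) : β⁻¹ ≤ branch β 1 x := by
  have : 0 < β⁻¹ := by positivity
  rw [branch_one]; nlinarith

/-- An orbit point whose expansion starts with `00`, and which lies above `v = 001⋯`, is followed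
along the first three digits. -/
lemma branch_of_lt_sq (hβ1 : 1 < β) (hβ2 : β < 2) {v v₃ u : ℝ} (hv₃ : 0 ≤ v₃)
    (hv : v = branch β 0 (branch β 0 (branch β 1 v₃))) (hu0 : 0 ≤ u) (hu : u < β⁻¹ ^ 2)
    (hvu : v < u) :
    u = branch β 0 (branch β 0 (branch β 1 ((betaMap β)^[3] u))) ∧ v₃ < (betaMap β)^[3] u := by
  have hb0 : 0 < β⁻¹ := by positivity
  have hb1 : β⁻¹ < 1 := inv_lt_one_of_one_lt₀ hβ1
  have e0 := eq_branch_zero hβ1 hu0 (by nlinarith)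
  have e1 := eq_branch_zero hβ1 (betaMap_mem β u).1 (by
    rw [e0, branch_zero, sq] at hu
    exact lt_of_mul_lt_mul_left hu hb0.le)
  have e2 := eq_branch_one hβ1 hβ2 (betaMap_mem β (betaMap β u)).2 (by
    rw [hv, e0, e1] at hvu
    exact (le_branch_one hβ1 hv₃).trans
      (lt_of_branch_lt_branch hβ1 (lt_of_branch_lt_branch hβ1 hvu)).le)
  have e : u = branch β 0 (branch β 0 (branch β 1 ((betaMap β)^[3] u))) := by
    conv_lhs => rw [e0, e1, e2]
    rfl
  refine ⟨e, ?_⟩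
  rw [hv, e] at hvu
  exact lt_of_branch_lt_branch hβ1 (lt_of_branch_lt_branch hβ1 (lt_of_branch_lt_branch hβ1 hvu))

/-- An orbit above `v` either decodes into blocks or contains `00`. -/
lemma false_of_orbit_above (hβ1 : 1 < β) (hβ2 : β < 2) (hβ : β ^ 3 = β ^ 2 + β + 1)
    {x v : ℝ} {p : ℕ} (hp : 0 < p) (hx : x ∈ Ico (0 : ℝ) 1)
    (hmin : Function.minimalPeriod (betaMap β) x = p) (hxv : ∀ n, v < (betaMap β)^[n] x)
    (hsmall : ∀ u, 0 ≤ u → u < β⁻¹ ^ 2 → v < u → (betaMap β)^[p] u = u → False)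
    (hchain : ∀ (O : Set ℝ) (y : ℝ) (ks : List ℕ), ks ≠ [] →
      (∀ u ∈ O, Function.minimalPeriod (betaMap β) u = p) →
      BlockChain β O ks y y → 2 * ks.length + 3 * ks.sum = p → False) : False := by
  by_cases hb : ∀ n, β⁻¹ ^ 2 ≤ (betaMap β)^[n] x
  · obtain ⟨O, y, ks, hO, hc, hs⟩ := exists_blockChain hβ1 hβ2 hβ hp hx hmin hxv hb
    refine hchain O y ks ?_ (fun u hu => (hO u hu).2) hc hs
    rintro rfl
    simp only [List.length_nil, List.sum_nil] at hs
    omega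
  · push Not at hb
    obtain ⟨n, hn⟩ := hb
    refine hsmall _ (iterate_betaMap_mem β hx n).1 hn (hxv n) ?_
    rw [← Function.iterate_add_apply, add_comm, Function.iterate_add_apply]
    congr 1
    rw [← hmin]; exact Function.iterate_minimalPeriod

lemma isGreatest_period_three (hβ1 : 1 < β) (hβ2 : β < 2) (hβ : β ^ 3 = β ^ 2 + β + 1)
    {v : ℝ} (hv0 : 0 ≤ v) (hv : v = wordBranch β [0, 0, 1] v) :
    IsGreatest (periodThresholds β 3) v := by
  obtain ⟨b1, b2, b3, b4, b5, b6⟩ := inv_tribonacci_bounds hβ1 hβ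
  have hw : v = branch β 0 (wordBranch β word01 v) := hv
  have hvb : v < β⁻¹ := by
    refine lt_of_wordBranch_lt hβ1 (by simp) hv ?_
    have : wordBranch β word01 β⁻¹ < 1 := by rw [wordBranch_word01]; nlinarith
    change branch β 0 (wordBranch β word01 β⁻¹) < β⁻¹
    rw [branch_zero]; nlinarith
  have hub : wordBranch β word01 v < β⁻¹ := (wordBranch_block_lt hβ1 hβ 0 hvb).trans b1
  have hv2 := lt_sq_of_eq_branch_zero hβ1 hw hub
  have hu : v < wordBranch β word01 v := hv2.trans_le (le_wordBranch_block hβ1 0 hv0)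
  have r := (rises_branch hβ1 v 0 (hv0.trans hu.le) (hub.trans b5)).trans hu
    (rises_word01 hβ1 hβ hvb hv0 hvb)
  rw [← hw] at r
  refine isGreatest_periodThresholds (r.mem_periodThresholds ⟨hv0, by linarith⟩ (by norm_num)) ?_
  intro x hx hmin hxv
  refine false_of_orbit_above hβ1 hβ2 hβ (by norm_num) hx hmin hxv ?_ ?_
  · intro u hu0 hu2 hvu hper
    obtain ⟨e, -⟩ := branch_of_lt_sq hβ1 hβ2 hv0 hv hu0 hu2 hvu
    rw [hper] at e
    exact hvu.ne (eq_of_wordBranch_eq hβ1 (w := [0, 0, 1]) (by simp) hv e)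
  · intro O y ks hne _ _ hs
    have := List.length_pos_iff.2 hne
    omega

lemma isGreatest_period_four (hβ1 : 1 < β) (hβ2 : β < 2) (hβ : β ^ 3 = β ^ 2 + β + 1)
    {v : ℝ} (hv0 : 0 ≤ v) (hv : v = wordBranch β [0, 0, 1, 1] v) :
    IsGreatest (periodThresholds β 4) v := by
  obtain ⟨b1, b2, b3, b4, b5, b6⟩ := inv_tribonacci_bounds hβ1 hβ
  have hw : v = branch β 0 (wordBranch β word011 v) := hv
  have hle : ∀ {t : ℝ}, 0 ≤ t → 1 - β⁻¹ ≤ wordBranch β word011 t := by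
    intro t ht
    rw [wordBranch_word011 hβ1 hβ]
    have : 0 ≤ β⁻¹ ^ 3 * t := by positivity
    linarith
  have hvb : v < β⁻¹ := by
    refine lt_of_wordBranch_lt hβ1 (by simp) hv ?_
    have : wordBranch β word011 β⁻¹ < 1 := by
      have h := inv_tribonacci hβ1 hβ
      rw [wordBranch_word011 hβ1 hβ, h]
      nlinarith
    change branch β 0 (wordBranch β word011 β⁻¹) < β⁻¹
    rw [branch_zero]; nlinarith
  have hub := wordBranch_word011_lt hβ1 hβ hvb
  have hv2 := lt_sq_of_eq_branch_zero hβ1 hw hub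
  have hu : v < wordBranch β word011 v := (hv2.trans b2).trans_le (hle hv0)
  have r := (rises_branch hβ1 v 0 (hv0.trans hu.le) (hub.trans b5)).trans hu
    (rises_word011 hβ1 hβ hvb hv0 hvb)
  rw [← hw] at r
  refine isGreatest_periodThresholds (r.mem_periodThresholds ⟨hv0, by linarith⟩ (by norm_num)) ?_
  intro x hx hmin hxv
  refine false_of_orbit_above hβ1 hβ2 hβ (by norm_num) hx hmin hxv ?_ ?_
  · intro u hu0 hu2 hvu hper
    have h1 := le_branch_one hβ1 hv0
    obtain ⟨e, h3⟩ := branch_of_lt_sq hβ1 hβ2 (b4.le.trans h1) hv hu0 hu2 hvu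
    have e3 := eq_branch_one hβ1 hβ2 (betaMap_mem β _).2 (h1.trans h3.le)
    have e4 : betaMap β ((betaMap β)^[3] u) = u :=
      (Function.iterate_succ_apply' (betaMap β) 3 u).symm.trans hper
    replace e3 : (betaMap β)^[3] u = branch β 1 (betaMap β ((betaMap β)^[3] u)) := e3
    rw [e4] at e3
    rw [e3] at e
    exact hvu.ne (eq_of_wordBranch_eq hβ1 (w := [0, 0, 1, 1]) (by simp) hv e)
  · intro O y ks hne hO hc hs
    have := List.length_pos_iff.2 hne
    match ks with
    | [] => simp at hne
    | [a] => simp only [List.length_cons, List.sum_cons, List.length_nil, List.sum_nil] at hs; omega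
    | a :: b :: c :: ks => simp only [List.length_cons, List.sum_cons] at hs; omega
    | [a, b] =>
      obtain ⟨h1, h2, h3, h4, h5, h6, h7, h8, h9⟩ := hc
      simp only [List.length_cons, List.sum_cons, List.length_nil, List.sum_nil] at hs
      rw [h9] at h6
      obtain rfl : a = 0 := by omega
      obtain rfl : b = 0 := by omega
      -- The only block word of length 4 is 0101, whose smallest period is 2.
      exact not_two_equal_blocks hβ1 (by rw [hO _ h1]) rfl h3 h6

lemma isGreatest_period_six (hβ1 : 1 < β) (hβ2 : β < 2) (hβ : β ^ 3 = β ^ 2 + β + 1)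
    {v : ℝ} (hv0 : 0 ≤ v) (hv : v = wordBranch β [0, 0, 1, 1, 0, 1] v) :
    IsGreatest (periodThresholds β 6) v := by
  obtain ⟨b1, b2, b3, b4, b5, b6⟩ := inv_tribonacci_bounds hβ1 hβ
  have hb := inv_tribonacci hβ1 hβ
  have hw : v = branch β 0 (wordBranch β word011 (wordBranch β word01 v)) := hv
  have hle : ∀ {t : ℝ}, 0 ≤ t → 1 - β⁻¹ ≤ wordBranch β word011 t := by
    intro t ht
    rw [wordBranch_word011 hβ1 hβ]
    have : 0 ≤ β⁻¹ ^ 3 * t := by positivity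
    linarith
  have hlt : ∀ {t : ℝ}, t < β⁻¹ → wordBranch β word01 t < β⁻¹ := fun ht =>
    (wordBranch_block_lt hβ1 hβ 0 ht).trans b1
  have hvb : v < β⁻¹ := by
    refine lt_of_wordBranch_lt hβ1 (by simp) hv ?_
    have : wordBranch β word01 β⁻¹ < β⁻¹ := by
      rw [wordBranch_word01]; nlinarith
    have := wordBranch_word011_lt hβ1 hβ this
    change branch β 0 (wordBranch β word011 (wordBranch β word01 β⁻¹)) < β⁻¹
    rw [branch_zero]; nlinarith
  have hwb := hlt hvb
  have hub := wordBranch_word011_lt hβ1 hβ hwb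
  have hv2 := lt_sq_of_eq_branch_zero hβ1 hw hub
  have hv01 : v < wordBranch β word01 v := hv2.trans_le (le_wordBranch_block hβ1 0 hv0)
  have h01 := hv0.trans hv01.le
  have hu : v < wordBranch β word011 (wordBranch β word01 v) := (hv2.trans b2).trans_le (hle h01)
  have r := (rises_branch hβ1 v 0 (hv0.trans hu.le) (hub.trans b5)).trans hu
    ((rises_word011 hβ1 hβ hvb h01 hwb).trans hv01 (rises_word01 hβ1 hβ hvb hv0 hvb))
  rw [← hw] at r
  refine isGreatest_periodThresholds (r.mem_periodThresholds ⟨hv0, by linarith⟩ (by norm_num)) ?_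
  intro x hx hmin hxv
  refine false_of_orbit_above hβ1 hβ2 hβ (by norm_num) hx hmin hxv ?_ ?_
  · intro u hu0 hu2 hvu hper
    have h1 : β⁻¹ ≤ branch β 1 (wordBranch β word01 v) := le_branch_one hβ1 h01
    obtain ⟨e, h3⟩ := branch_of_lt_sq hβ1 hβ2 (b4.le.trans h1) hv hu0 hu2 hvu
    have e3 := eq_branch_one hβ1 hβ2 (betaMap_mem β _).2 (h1.trans h3.le)
    set u₃ := (betaMap β)^[3] u with hu₃
    change u₃ = branch β 1 (betaMap β u₃) at e3
    have m4 := betaMap_mem β u₃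
    have h4 : betaMap β u₃ < β⁻¹ := by
      by_contra! hge
      have e4 := eq_branch_one hβ1 hβ2 m4.2 hge
      have h5 := (betaMap_mem β (betaMap β u₃)).1
      have hsq : branch β 1 u₃ ≥ 1 := by
        rw [e3, e4, branch_one, branch_one, branch_one]
        have : 0 < β⁻¹ ^ 3 := by positivity
        nlinarith
      rw [e, branch_zero, branch_zero] at hu2
      nlinarith
    have e4 := eq_branch_zero hβ1 m4.1 h4
    rw [e3] at h3
    have h4' : wordBranch β word01 v < betaMap β u₃ := lt_of_branch_lt_branch hβ1 h3
    rw [e4] at h4'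
    have h5 : branch β 1 v < betaMap β (betaMap β u₃) := lt_of_branch_lt_branch hβ1 h4'
    have e5 := eq_branch_one hβ1 hβ2 (betaMap_mem β _).2 ((le_branch_one hβ1 hv0).trans h5.le)
    have e6 : betaMap β (betaMap β (betaMap β u₃)) = u := hper
    rw [e6] at e5
    rw [e3, e4, e5] at e
    exact hvu.ne (eq_of_wordBranch_eq hβ1 (w := [0, 0, 1, 1, 0, 1]) (by simp) hv e)
  · intro O y ks hne hO hc hs
    have := List.length_pos_iff.2 hne
    match ks with
    | [] => simp at hne
    | [a] => simp only [List.length_cons, List.sum_cons, List.length_nil, List.sum_nil] at hs; omega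
    | [a, b] =>
      simp only [List.length_cons, List.sum_cons, List.length_nil, List.sum_nil] at hs; omega
    | a :: b :: c :: d :: ks => simp only [List.length_cons, List.sum_cons] at hs; omega
    | [a, b, c] =>
      obtain ⟨h1, h2, h3, h4, h5, h6, h7, h8, h9, h10, h11, h12⟩ := hc
      simp only [List.length_cons, List.sum_cons, List.length_nil, List.sum_nil] at hs
      rw [h12] at h9
      obtain rfl : a = 0 := by omega
      obtain rfl : b = 0 := by omega
      obtain rfl : c = 0 := by omega
      -- The only block word of length 6 is 010101, whose smallest period is 2.
      exact not_three_equal_blocks hβ1 (by rw [hO _ h1]) rfl h3 h6 h9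

end Small

/-! ### Critical values -/

section Critical

variable {β : ℝ}

lemma isGreatest_word_one_block (hβ1 : 1 < β) (hβ2 : β < 2) (hβ : β ^ 3 = β ^ 2 + β + 1) (m : ℕ) :
    IsGreatest (periodThresholds β (3 * m + 2))
      (betaValue β (wordInf (word01 ++ wordPow word011 m))) := by
  rw [add_comm]
  exact isGreatest_one_block hβ1 hβ2 hβ (betaValue_nonneg hβ1 _) (betaValue_wordInf hβ1 _)

lemma isGreatest_word_two_blocks (hβ1 : 1 < β) (hβ2 : β < 2) (hβ : β ^ 3 = β ^ 2 + β + 1)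
    {k l p : ℕ} (hl : l = k + 1 ∨ l = k + 2) (hp : p = 4 + 3 * (k + l)) :
    IsGreatest (periodThresholds β p)
      (betaValue β (wordInf (word01 ++ wordPow word011 k ++ word01 ++ wordPow word011 l))) := by
  have h := betaValue_wordInf hβ1 (word01 ++ wordPow word011 k ++ word01 ++ wordPow word011 l)
  set v := betaValue β (wordInf (word01 ++ wordPow word011 k ++ word01 ++ wordPow word011 l))
  have e : word01 ++ wordPow word011 k ++ word01 ++ wordPow word011 l = block k ++ block l := by
    simp only [block, List.append_assoc]
  rw [e, wordBranch_append] at h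
  rw [show p = 2 + 3 * k + (2 + 3 * l) by omega]
  exact isGreatest_two_blocks hβ1 hβ2 hβ (betaValue_nonneg hβ1 _) h rfl hl

lemma isGreatest_word_three_blocks (hβ1 : 1 < β) (hβ2 : β < 2) (hβ : β ^ 3 = β ^ 2 + β + 1)
    {k l m p : ℕ} (hm : m = k + 1) (hl : k ≤ l) (hl2 : l ≤ k + 2)
    (hp : p = 6 + 3 * (k + l + m)) :
    IsGreatest (periodThresholds β p)
      (betaValue β (wordInf (word01 ++ wordPow word011 k ++ word01 ++ wordPow word011 l ++
        word01 ++ wordPow word011 m))) := by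
  have h := betaValue_wordInf hβ1 (word01 ++ wordPow word011 k ++ word01 ++ wordPow word011 l ++
        word01 ++ wordPow word011 m)
  set v := betaValue β (wordInf (word01 ++ wordPow word011 k ++ word01 ++ wordPow word011 l ++
        word01 ++ wordPow word011 m))
  have e : word01 ++ wordPow word011 k ++ word01 ++ wordPow word011 l ++
        word01 ++ wordPow word011 m = block k ++ (block l ++ block m) := by
    simp only [block, List.append_assoc]
  rw [e, wordBranch_append, wordBranch_append] at h
  rw [show p = 2 + 3 * k + (2 + 3 * l + (2 + 3 * m)) by omega]
  exact isGreatest_three_blocks hβ1 hβ2 hβ (betaValue_nonneg hβ1 _) h rfl rfl hm hl hl2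

lemma periodThresholds_nonempty (hβ1 : 1 < β) (hβ2 : β < 2) (hβ : β ^ 3 = β ^ 2 + β + 1) {p : ℕ}
    (hp : 1 ≤ p) : (periodThresholds β p).Nonempty := by
  obtain ⟨m, rfl | rfl | rfl⟩ : ∃ m, p = 3 * m + 2 ∨ p = 3 * m + 1 ∨ p = 3 * (m + 1) :=
    ⟨(p - 1) / 3, by omega⟩
  · exact (isGreatest_word_one_block hβ1 hβ2 hβ m).nonempty
  · rcases m with _ | _ | m
    · exact (isGreatest_period_one hβ1 hβ2).nonempty
    · exact (isGreatest_period_four hβ1 hβ2 hβ (betaValue_nonneg hβ1 _)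
        (betaValue_wordInf hβ1 _)).nonempty
    · rcases Nat.even_or_odd' m with ⟨z, rfl | rfl⟩
      · exact (isGreatest_word_two_blocks hβ1 hβ2 hβ (k := z) (Or.inl rfl) (by omega)).nonempty
      · exact (isGreatest_word_two_blocks hβ1 hβ2 hβ (k := z) (Or.inr rfl) (by omega)).nonempty
  · rcases m with _ | _ | m
    · exact (isGreatest_period_three hβ1 hβ2 hβ (betaValue_nonneg hβ1 _)
        (betaValue_wordInf hβ1 _)).nonempty
    · exact (isGreatest_period_six hβ1 hβ2 hβ (betaValue_nonneg hβ1 _)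
        (betaValue_wordInf hβ1 _)).nonempty
    -- The remainder `m % 3` is put entirely on the middle exponent, which covers the three residue
    -- cases at once.
    · exact (isGreatest_word_three_blocks hβ1 hβ2 hβ (k := m / 3) (l := m / 3 + m % 3) rfl
        (by omega) (by omega) (by omega)).nonempty

end Critical

theorem theorem5p8 (β : ℝ) (hβ1 : 1 < β) (hβ2 : β < 2) (hβ : β ^ 3 = β ^ 2 + β + 1) :
    -- the quasi-greedy expansion of 1 is (110)^∞
    IsQuasiGreedyExpansion β 1 (wordInf [1, 1, 0]) ∧
    -- the suprema are taken over nonempty sets that are bounded above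
    (∀ p : ℕ, 1 ≤ p → (periodThresholds β p).Nonempty ∧ BddAbove (periodThresholds β p)) ∧
    criticalValue β 1 = 0 ∧
    criticalValue β 3 = betaValue β (wordInf [0, 0, 1]) ∧
    criticalValue β 4 = betaValue β (wordInf [0, 0, 1, 1]) ∧
    criticalValue β 6 = betaValue β (wordInf [0, 0, 1, 1, 0, 1]) ∧
    (∀ m : ℕ, criticalValue β (3 * m + 2) =
      betaValue β (wordInf (word01 ++ wordPow word011 m))) ∧
    (∀ z : ℕ, 1 ≤ z → criticalValue β (3 * (2 * z) + 1) =
      betaValue β (wordInf (word01 ++ wordPow word011 (z - 1) ++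
        word01 ++ wordPow word011 z))) ∧
    (∀ z : ℕ, 1 ≤ z → criticalValue β (3 * (2 * z + 1) + 1) =
      betaValue β (wordInf (word01 ++ wordPow word011 (z - 1) ++
        word01 ++ wordPow word011 (z + 1)))) ∧
    (∀ z : ℕ, 1 ≤ z → criticalValue β (3 * (3 * z)) =
      betaValue β (wordInf (word01 ++ wordPow word011 (z - 1) ++
        word01 ++ wordPow word011 (z - 1) ++ word01 ++ wordPow word011 z))) ∧
    (∀ z : ℕ, 1 ≤ z → criticalValue β (3 * (3 * z + 1)) =
      betaValue β (wordInf (word01 ++ wordPow word011 (z - 1) ++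
        word01 ++ wordPow word011 z ++ word01 ++ wordPow word011 z))) ∧
    (∀ z : ℕ, 1 ≤ z → criticalValue β (3 * (3 * z + 2)) =
      betaValue β (wordInf (word01 ++ wordPow word011 (z - 1) ++
        word01 ++ wordPow word011 (z + 1) ++ word01 ++ wordPow word011 z))) := by
  refine ⟨isQuasiGreedyExpansion_one hβ1 hβ, fun p hp =>
    ⟨periodThresholds_nonempty hβ1 hβ2 hβ hp, 1, fun t ht => ht.1.2.le⟩,
    (isGreatest_period_one hβ1 hβ2).csSup_eq,
    (isGreatest_period_three hβ1 hβ2 hβ (betaValue_nonneg hβ1 _)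
      (betaValue_wordInf hβ1 _)).csSup_eq,
    (isGreatest_period_four hβ1 hβ2 hβ (betaValue_nonneg hβ1 _)
      (betaValue_wordInf hβ1 _)).csSup_eq,
    (isGreatest_period_six hβ1 hβ2 hβ (betaValue_nonneg hβ1 _)
      (betaValue_wordInf hβ1 _)).csSup_eq,
    fun m => (isGreatest_word_one_block hβ1 hβ2 hβ m).csSup_eq,
    fun z hz => (isGreatest_word_two_blocks hβ1 hβ2 hβ (by omega) (by omega)).csSup_eq,
    fun z hz => (isGreatest_word_two_blocks hβ1 hβ2 hβ (by omega) (by omega)).csSup_eq,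
    fun z hz => (isGreatest_word_three_blocks hβ1 hβ2 hβ (by omega) (by omega) (by omega)
      (by omega)).csSup_eq,
    fun z hz => (isGreatest_word_three_blocks hβ1 hβ2 hβ (by omega) (by omega) (by omega)
      (by omega)).csSup_eq,
    fun z hz => (isGreatest_word_three_blocks hβ1 hβ2 hβ (by omega) (by omega) (by omega)
      (by omega)).csSup_eq⟩
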